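/- Let $C\in\mathbb{R}^{n\times n}$ be symmetric positive definite with smallest eigenvalue $\lambda_{\min}(C)$, and let $s$ be an integer with $1\le s\le n$. For $0\le t\le\lambda_{\min}(C)$ let $A(t)\in\mathbb{R}^{n\times n}$ be any matrix with $C-tI=A(t)^{\top}A(t)$ (for instance a Cholesky factor), with columns $a_1(t),\dots,a_n(t)$. For a symmetric positive semidefinite $n\times n$ matrix $X$ with eigenvalues $\lambda_1(X)\ge\dots\ge\lambda_n(X)$ let $\Phi_s(X;t)=\sum_{i=1}^{s}\log(\lambda_i(X)+t)$, where $\log 0=-\infty$, and let $\widehat\Phi_s(\cdot\,;t)$ be the concave envelope of $\Phi_s(\cdot\,;t)$ on the cone of positive semidefinite matrices, i.e. the pointwise infimum of all concave functions on that cone that are everywhere at least $\Phi_s(\cdot\,;t)$. Define the augmented factorization bound $$\hat z(t)=\max\Big\{\widehat\Phi_s\Big(\sum_{i=1}^n x_i\,a_i(t)a_i(t)^{\top};\,t\Big)\;:\;x\in[0,1]^n,\ \sum_{i=1}^n x_i=s\Big\};$$ for $t=0$ this is Nikolov's factorization bound. Then, for every $t$ with $0<t\le\lambda_{\min}(C)$,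 the maxima $\hat z(0)$ and $\hat z(t)$ are attained and finite, and $\hat z(0)\ge\hat z(t)$; that is, the augmented factorization bound is at least as tight as the factorization bound. -/

import Mathlib

open scoped Matrix

/-- The vector of eigenvalues of a symmetric real matrix, in nonincreasing order and with
multiplicity (it is only used for symmetric matrices; elsewhere it is set to `0`). -/
noncomputable def sortedEigenvalues {n : ℕ} (X : Matrix (Fin n) (Fin n) ℝ) : Fin n → ℝ :=
  open Classical in
  fun i => if h : X.IsHermitian then h.eigenvalues₀ (Fin.cast (Fintype.card_fin n).symm i) else 0

/-- The function `Φ_s(X; t) = ∑_{i ≤ s} log (λ_i(X) + t)`, with `log 0 = -∞`.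
The index `i : Fin n` stands for the `(i + 1)`-st largest eigenvalue. -/
noncomputable def Phi {n : ℕ} (s : ℕ) (t : ℝ) (X : Matrix (Fin n) (Fin n) ℝ) : EReal :=
  ∑ i : Fin n with i.val < s, ENNReal.log (ENNReal.ofReal (sortedEigenvalues X i + t))

/-- An extended-real-valued function is concave on `S` if its hypograph over `S` is convex. -/
def IsConcaveOn {E : Type*} [AddCommGroup E] [Module ℝ E] (S : Set E) (F : E → EReal) : Prop :=
  Convex ℝ {p : E × ℝ | p.1 ∈ S ∧ (p.2 : EReal) ≤ F p.1}

/-- The concave envelope on `S` of an extended-real-valued function `f`: the pointwise infimum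
of all functions that are concave on `S` and lie above `f` on `S`. -/
noncomputable def concaveEnvelope {E : Type*} [AddCommGroup E] [Module ℝ E]
    (S : Set E) (f : E → EReal) (x : E) : EReal :=
  sInf {v : EReal | ∃ F : E → EReal, IsConcaveOn S F ∧ (∀ y ∈ S, f y ≤ F y) ∧ v = F x}

/-- The concave envelope of `Φ_s(·; t)` on the cone of positive semidefinite matrices. -/
noncomputable def PhiHat {n : ℕ} (s : ℕ) (t : ℝ) (X : Matrix (Fin n) (Fin n) ℝ) : EReal :=
  concaveEnvelope {Y : Matrix (Fin n) (Fin n) ℝ | Y.PosSemidef} (Phi s t) X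

/-- The matrix `∑ i, x_i a_i a_iᵀ`, where `a_i` is the `i`-th column of `A`. -/
def weightedGram {n : ℕ} (A : Matrix (Fin n) (Fin n) ℝ) (x : Fin n → ℝ) :
    Matrix (Fin n) (Fin n) ℝ :=
  ∑ i : Fin n, x i • Matrix.vecMulVec (A.col i) (A.col i)

/-- `A` is a factor of `C - t I`, that is `C - t I = Aᵀ A`. -/
def IsFactor {n : ℕ} (C : Matrix (Fin n) (Fin n) ℝ) (t : ℝ)
    (A : Matrix (Fin n) (Fin n) ℝ) : Prop :=
  C - t • (1 : Matrix (Fin n) (Fin n) ℝ) = Aᵀ * A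

/-- The objective values of the augmented factorization relaxation with parameter `t` and factor
`A` of `C - t I`, over all `x ∈ [0,1]^n` with `∑ i, x_i = s`. Its greatest element is the
augmented factorization bound; for `t = 0` it is the factorization bound. -/
def augFactValues {n : ℕ} (s : ℕ) (t : ℝ) (A : Matrix (Fin n) (Fin n) ℝ) : Set EReal :=
  {v : EReal | ∃ x : Fin n → ℝ, (∀ i, x i ∈ Set.Icc (0 : ℝ) 1) ∧ ∑ i, x i = (s : ℝ) ∧
    v = PhiHat s t (weightedGram A x)}

/-! Let `Z = W diag(z) Wᵀ` with `W` orthogonal and `z` positive and nondecreasing. Tangents to the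
logarithm at the points `1 / z i`, combined with von Neumann's trace inequality, make `X ↦ tr(Z X) +
dualConst s t z` an affine majorant of `Φ_s(·; t)`, hence of its envelope. These majorants determine
the envelope (`exists_dual_lt`): writing the eigenvalues as `p i * v i` with `p` in the hypersimplex
gives the lower bound `∑ p i * log (v i + t)`, which `z i = 1 / (v i + t)` matches.

The two bounds are compared at each fixed `x`. With `R = diag(√x)`, the matrices in the relaxations
for `0` and `t` have the spectra of `M = R C R` and `N = M - t diag(x)`. Take `Z` nearly optimal for
`M`, in an eigenbasis of `M`. Passing to `N` lowers `tr(Z ·)` by `t tr(Z diag(x))`, which by Ky Fan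
(`sum_le_trace_diagonal`) is at least `t` times the sum of the `s` smallest `z i`; `dualConst` rises
by exactly that sum times `t`. -/

/-! ### Sorted eigenvalues and the spectral theorem. -/

theorem antitone_eq_of_map_univ_eq {n : ℕ} {f g : Fin n → ℝ} (hf : Antitone f) (hg : Antitone g)
    (h : Finset.univ.val.map f = Finset.univ.val.map g) : f = g := by
  have key : ∀ f : Fin n → ℝ, Antitone f →
      (Finset.univ.val.map f).sort (· ≥ ·) = List.ofFn f := by
    intro f hf
    simp_rw [Fin.univ_val_map, Multiset.coe_sort]
    apply List.mergeSort_of_pairwise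
    simp_rw [decide_eq_true_eq, ← List.sortedGE_iff_pairwise]
    exact hf.sortedGE_ofFn
  rw [← List.ofFn_inj, ← key f hf, ← key g hg, h]

theorem exists_antitone_comp_perm {n : ℕ} (f : Fin n → ℝ) :
    ∃ σ : Equiv.Perm (Fin n), Antitone (f ∘ σ) := by
  refine ⟨Tuple.sort (fun i => - f i), fun i j hij => ?_⟩
  have := Tuple.monotone_sort (fun i => - f i) hij
  simpa using this

theorem map_comp_perm_univ {n : ℕ} (f : Fin n → ℝ) (σ : Equiv.Perm (Fin n)) :
    Finset.univ.val.map (f ∘ σ) = Finset.univ.val.map f := by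
  rw [← Multiset.map_map, Multiset.map_univ_val_equiv]

theorem exists_perm_of_map_univ_eq {n : ℕ} {f g : Fin n → ℝ}
    (h : Finset.univ.val.map f = Finset.univ.val.map g) :
    ∃ σ : Equiv.Perm (Fin n), ∀ i, f i = g (σ i) := by
  obtain ⟨σ, hσ⟩ := exists_antitone_comp_perm f
  obtain ⟨τ, hτ⟩ := exists_antitone_comp_perm g
  have := antitone_eq_of_map_univ_eq hσ hτ (by rw [map_comp_perm_univ, map_comp_perm_univ, h])
  refine ⟨σ⁻¹.trans τ, fun i => ?_⟩
  have := congrFun this (σ⁻¹ i)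
  simpa using this

theorem sortedEigenvalues_of_isHermitian {n : ℕ} {X : Matrix (Fin n) (Fin n) ℝ}
    (h : X.IsHermitian) (i : Fin n) :
    sortedEigenvalues X i = h.eigenvalues₀ (Fin.cast (Fintype.card_fin n).symm i) := by
  unfold sortedEigenvalues
  rw [dif_pos h]

theorem sortedEigenvalues_antitone {n : ℕ} (X : Matrix (Fin n) (Fin n) ℝ) :
    Antitone (sortedEigenvalues X) := by
  by_cases h : X.IsHermitian
  · intro i j hij
    simp only [sortedEigenvalues_of_isHermitian h]
    exact h.eigenvalues₀_antitone (by simpa using hij)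
  · intro i j _
    unfold sortedEigenvalues
    rw [dif_neg h, dif_neg h]

theorem map_sortedEigenvalues {n : ℕ} {X : Matrix (Fin n) (Fin n) ℝ} (h : X.IsHermitian) :
    Finset.univ.val.map (sortedEigenvalues X) = X.charpoly.roots := by
  rw [h.roots_charpoly_eq_eigenvalues₀,
    ← Multiset.map_univ_val_equiv (finCongr (Fintype.card_fin n).symm), Multiset.map_map]
  refine Multiset.map_congr rfl fun i _ => ?_
  simp [sortedEigenvalues_of_isHermitian h]

theorem sortedEigenvalues_congr {n : ℕ} {X Y : Matrix (Fin n) (Fin n) ℝ} (hX : X.IsHermitian)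
    (hY : Y.IsHermitian) (h : X.charpoly = Y.charpoly) :
    sortedEigenvalues X = sortedEigenvalues Y :=
  antitone_eq_of_map_univ_eq (sortedEigenvalues_antitone X) (sortedEigenvalues_antitone Y)
    (by rw [map_sortedEigenvalues hX, map_sortedEigenvalues hY, h])

theorem roots_charpoly_conj_diagonal {n : ℕ} {W : Matrix (Fin n) (Fin n) ℝ} (hW : Wᵀ * W = 1)
    (y : Fin n → ℝ) :
    (W * Matrix.diagonal y * Wᵀ).charpoly.roots = Finset.univ.val.map y := by
  rw [Matrix.charpoly_mul_comm, ← mul_assoc, hW, one_mul, Matrix.charpoly_diagonal,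
    Polynomial.roots_prod]
  · simp
  · simp [Finset.prod_ne_zero_iff, Polynomial.X_sub_C_ne_zero]

theorem isHermitian_conj_diagonal {n : ℕ} (W : Matrix (Fin n) (Fin n) ℝ) (y : Fin n → ℝ) :
    (W * Matrix.diagonal y * Wᵀ).IsHermitian := by
  simp [Matrix.IsHermitian, mul_assoc, Matrix.conjTranspose_eq_transpose_of_trivial]

theorem posSemidef_conj_diagonal {n : ℕ} (W : Matrix (Fin n) (Fin n) ℝ) {y : Fin n → ℝ}
    (hy : ∀ i, 0 ≤ y i) : (W * Matrix.diagonal y * Wᵀ).PosSemidef := by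
  have := (Matrix.PosSemidef.diagonal (R := ℝ) (d := y) hy).mul_mul_conjTranspose_same W
  simpa [Matrix.conjTranspose_eq_transpose_of_trivial] using this

theorem exists_perm_sortedEigenvalues_conj_diagonal {n : ℕ} {W : Matrix (Fin n) (Fin n) ℝ}
    (hW : Wᵀ * W = 1) (y : Fin n → ℝ) :
    ∃ σ : Equiv.Perm (Fin n), ∀ i, y i =
      sortedEigenvalues (W * Matrix.diagonal y * Wᵀ) (σ i) :=
  exists_perm_of_map_univ_eq (by
    rw [map_sortedEigenvalues (isHermitian_conj_diagonal W y), roots_charpoly_conj_diagonal hW])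

/-- The spectral theorem, with the eigenvalues in nonincreasing order. -/
theorem exists_orthogonal_eq_conj_diagonal {n : ℕ} {X : Matrix (Fin n) (Fin n) ℝ}
    (h : X.IsHermitian) :
    ∃ W : Matrix (Fin n) (Fin n) ℝ, Wᵀ * W = 1 ∧ W * Wᵀ = 1 ∧
      X = W * Matrix.diagonal (sortedEigenvalues X) * Wᵀ := by
  obtain ⟨σ, hσ⟩ : ∃ σ : Equiv.Perm (Fin n), ∀ i, sortedEigenvalues X i = h.eigenvalues (σ i) := by
    refine exists_perm_of_map_univ_eq ?_
    rw [map_sortedEigenvalues h, h.roots_charpoly_eq_eigenvalues]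
    rfl
  set U : Matrix (Fin n) (Fin n) ℝ := h.eigenvectorUnitary.1 with hU
  have hU1 : Uᵀ * U = 1 := by
    have := Unitary.coe_star_mul_self h.eigenvectorUnitary
    simpa [Matrix.star_eq_conjTranspose, Matrix.conjTranspose_eq_transpose_of_trivial] using this
  have hU2 : U * Uᵀ = 1 := mul_eq_one_comm.mp hU1
  have hX : X = U * Matrix.diagonal h.eigenvalues * Uᵀ := by
    have := h.spectral_theorem
    rw [Unitary.conjStarAlgAut_apply] at this
    simpa [Matrix.star_eq_conjTranspose, Matrix.conjTranspose_eq_transpose_of_trivial,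
      Function.comp_def] using this
  have hW1 : (U.submatrix id σ)ᵀ * U.submatrix id σ = 1 := by
    rw [Matrix.transpose_submatrix, Matrix.submatrix_mul _ _ _ _ _ Function.bijective_id |>.symm, hU1]
    exact Matrix.submatrix_one_equiv σ
  refine ⟨U.submatrix id σ, hW1, mul_eq_one_comm.mp hW1, ?_⟩
  have hd : Matrix.diagonal (sortedEigenvalues X) =
      (Matrix.diagonal h.eigenvalues).submatrix σ σ := by
    rw [Matrix.submatrix_diagonal_equiv]
    congr 1
    exact funext hσ
  rw [hd, Matrix.transpose_submatrix, ← Matrix.submatrix_mul _ _ _ _ _ σ.bijective,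
    ← Matrix.submatrix_mul _ _ _ _ _ σ.bijective, ← hX, Matrix.submatrix_id_id]

theorem sortedEigenvalues_nonneg {n : ℕ} {X : Matrix (Fin n) (Fin n) ℝ} (h : X.PosSemidef)
    (i : Fin n) : 0 ≤ sortedEigenvalues X i := by
  have : sortedEigenvalues X i ∈ Finset.univ.val.map h.isHermitian.eigenvalues := by
    have e : Finset.univ.val.map h.isHermitian.eigenvalues =
        Finset.univ.val.map (sortedEigenvalues X) := by
      rw [map_sortedEigenvalues h.isHermitian, h.isHermitian.roots_charpoly_eq_eigenvalues]
      rfl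
    rw [e]
    exact Multiset.mem_map_of_mem _ (Finset.mem_univ i)
  obtain ⟨j, _, hj⟩ := Multiset.mem_map.mp this
  rw [← hj]
  exact h.eigenvalues_nonneg j

/-! ### Doubly stochastic matrices and the trace inequality. -/

theorem sum_sq_orthogonal {n : ℕ} {Q : Matrix (Fin n) (Fin n) ℝ} (h : Q * Qᵀ = 1) (i : Fin n) :
    ∑ j, Q i j ^ 2 = 1 := by
  have := congrFun (congrFun h i) i
  simpa [Matrix.mul_apply, sq] using this

theorem sq_mem_doublyStochastic {n : ℕ} {Q : Matrix (Fin n) (Fin n) ℝ} (h : Q * Qᵀ = 1)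
    (h' : Qᵀ * Q = 1) : Matrix.of (fun i j => Q i j ^ 2) ∈ doublyStochastic ℝ (Fin n) := by
  rw [mem_doublyStochastic_iff_sum]
  refine ⟨fun i j => sq_nonneg _, fun i => ?_, fun j => ?_⟩
  · simpa using sum_sq_orthogonal h i
  · have := sum_sq_orthogonal (Q := Qᵀ) (by simpa using h') j
    simpa using this

theorem trace_conj_diagonal_mul {n : ℕ} (W : Matrix (Fin n) (Fin n) ℝ) (z : Fin n → ℝ)
    (Y : Matrix (Fin n) (Fin n) ℝ) :
    (W * Matrix.diagonal z * Wᵀ * Y).trace = ∑ i, z i * (Wᵀ * Y * W) i i := by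
  rw [mul_assoc, mul_assoc, Matrix.trace_mul_comm, mul_assoc, Matrix.trace]
  simp [Matrix.diagonal_mul, mul_assoc]

/-- By Birkhoff's theorem the right side is an average over permutations, and the rearrangement
inequality bounds each term. -/
theorem sum_mul_le_of_doublyStochastic {n : ℕ} {P : Matrix (Fin n) (Fin n) ℝ}
    (hP : P ∈ doublyStochastic ℝ (Fin n)) {z l : Fin n → ℝ} (hz : Monotone z) (hl : Antitone l) :
    ∑ i, z i * l i ≤ ∑ i, z i * ∑ j, P i j * l j := by
  obtain ⟨w, hw0, hw1, rfl⟩ := exists_eq_sum_perm_of_mem_doublyStochastic hP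
  have e : ∑ i, z i * ∑ j, (∑ σ, w σ • σ.permMatrix ℝ) i j * l j
      = ∑ σ : Equiv.Perm (Fin n), w σ * ∑ i, z i * l (σ i) := by
    simp_rw [Matrix.sum_apply, Finset.sum_mul, Finset.mul_sum]
    rw [Finset.sum_congr rfl fun i _ => Finset.sum_comm, Finset.sum_comm]
    refine Finset.sum_congr rfl fun σ _ => Finset.sum_congr rfl fun i _ => ?_
    simp [Equiv.Perm.permMatrix, Equiv.toPEquiv_apply, PEquiv.toMatrix_apply, ite_mul]
    ring
  rw [e]
  calc ∑ i, z i * l i = ∑ σ : Equiv.Perm (Fin n), w σ * ∑ i, z i * l i := by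
        rw [← Finset.sum_mul, hw1, one_mul]
    _ ≤ _ := Finset.sum_le_sum fun σ _ => mul_le_mul_of_nonneg_left
        ((hz.antivary hl).sum_mul_le_sum_mul_comp_perm) (hw0 σ)

/-- Von Neumann's trace inequality, lower bound. -/
theorem sum_mul_sortedEigenvalues_le_trace {n : ℕ} {W Y : Matrix (Fin n) (Fin n) ℝ}
    (hW : Wᵀ * W = 1) (hY : Y.IsHermitian) {z : Fin n → ℝ} (hz : Monotone z) :
    ∑ i, z i * sortedEigenvalues Y i ≤ (W * Matrix.diagonal z * Wᵀ * Y).trace := by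
  obtain ⟨V, hV1, hV2, hV⟩ := exists_orthogonal_eq_conj_diagonal hY
  have hW' : W * Wᵀ = 1 := mul_eq_one_comm.mp hW
  have hQ : (Wᵀ * V) * (Wᵀ * V)ᵀ = 1 := by
    rw [Matrix.transpose_mul, Matrix.transpose_transpose, mul_assoc, ← mul_assoc V, hV2, one_mul,
      hW]
  refine (sum_mul_le_of_doublyStochastic (sq_mem_doublyStochastic hQ (mul_eq_one_comm.mp hQ)) hz
    (sortedEigenvalues_antitone Y)).trans_eq ?_
  rw [trace_conj_diagonal_mul]
  refine Finset.sum_congr rfl fun i _ => ?_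
  congr 1
  have : Wᵀ * Y * W = (Wᵀ * V) * Matrix.diagonal (sortedEigenvalues Y) * (Wᵀ * V)ᵀ := by
    conv_lhs => rw [hV]
    simp only [Matrix.transpose_mul, Matrix.transpose_transpose, mul_assoc]
  rw [this, Matrix.mul_apply]
  refine Finset.sum_congr rfl fun j _ => ?_
  simp only [Matrix.of_apply, Matrix.mul_diagonal, Matrix.transpose_apply]
  ring

/-! ### Affine majorants and weak duality. -/

theorem EReal.coe_sum_real {ι : Type*} (S : Finset ι) (f : ι → ℝ) :
    ((∑ i ∈ S, f i : ℝ) : EReal) = ∑ i ∈ S, (f i : EReal) := by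
  classical
  induction S using Finset.induction_on with
  | empty => simp
  | insert a S ha ih => rw [Finset.sum_insert ha, Finset.sum_insert ha, EReal.coe_add, ih]

/-- The constant term of the affine majorant of `Φ_s(·; t)` whose slope has eigenvalues `z`. -/
noncomputable def dualConst {n : ℕ} (s : ℕ) (t : ℝ) (z : Fin n → ℝ) : ℝ :=
  ∑ i : Fin n with i.val < s, (-Real.log (z i) - 1 + t * z i)

theorem log_ofReal_le_tangent {y z : ℝ} (hz : 0 < z) :
    ENNReal.log (ENNReal.ofReal y) ≤ ((z * y - Real.log z - 1 : ℝ) : EReal) := by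
  rcases le_or_gt y 0 with hy | hy
  · rw [ENNReal.ofReal_of_nonpos hy, ENNReal.log_zero]
    exact bot_le
  · rw [ENNReal.log_ofReal_of_pos hy, EReal.coe_le_coe_iff]
    have := Real.log_le_sub_one_of_pos (mul_pos hz hy)
    rw [Real.log_mul hz.ne' hy.ne'] at this
    linarith

/-- Tangent bounds control the top `s` terms; the other products `z i * λ_i` are nonnegative, so the
sum may run over all `i` and be compared with a trace. -/
theorem Phi_le_sum {n : ℕ} (s : ℕ) (t : ℝ) {Y : Matrix (Fin n) (Fin n) ℝ} (hY : Y.PosSemidef)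
    {z : Fin n → ℝ} (hz : ∀ i, 0 < z i) :
    Phi s t Y ≤ ((∑ i, z i * sortedEigenvalues Y i + dualConst s t z : ℝ) : EReal) := by
  calc Phi s t Y
      ≤ ∑ i : Fin n with i.val < s,
        ((z i * (sortedEigenvalues Y i + t) - Real.log (z i) - 1 : ℝ) : EReal) :=
        Finset.sum_le_sum fun i _ => log_ofReal_le_tangent (hz i)
    _ ≤ _ := by
        rw [← EReal.coe_sum_real, EReal.coe_le_coe_iff, dualConst]
        have h1 : ∑ i : Fin n with i.val < s, z i * sortedEigenvalues Y i ≤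
            ∑ i, z i * sortedEigenvalues Y i :=
          Finset.sum_le_sum_of_subset_of_nonneg (Finset.filter_subset _ _) fun i _ _ =>
            mul_nonneg (hz i).le (sortedEigenvalues_nonneg hY i)
        refine le_trans (le_of_eq ?_) (add_le_add_left h1 _)
        rw [← Finset.sum_add_distrib]
        exact Finset.sum_congr rfl fun i _ => by ring

theorem concaveEnvelope_le_of_affine {E : Type*} [AddCommGroup E] [Module ℝ E] {S : Set E}
    (hS : Convex ℝ S) {f : E → EReal} (l : E →ₗ[ℝ] ℝ) (c : ℝ)
    (h : ∀ y ∈ S, f y ≤ ((l y + c : ℝ) : EReal)) (x : E) :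
    concaveEnvelope S f x ≤ ((l x + c : ℝ) : EReal) := by
  refine sInf_le ⟨fun y => ((l y + c : ℝ) : EReal), ?_, h, rfl⟩
  rintro ⟨y, a⟩ ⟨hy, ha⟩ ⟨y', a'⟩ ⟨hy', ha'⟩ p q hp hq hpq
  rw [EReal.coe_le_coe_iff] at ha ha'
  refine ⟨hS hy hy' hp hq hpq, ?_⟩
  simp only [Prod.fst_add, Prod.snd_add, Prod.smul_fst, Prod.smul_snd, smul_eq_mul] at ha ha' ⊢
  rw [EReal.coe_le_coe_iff, map_add, map_smul, map_smul, smul_eq_mul, smul_eq_mul]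
  have h1 := mul_le_mul_of_nonneg_left ha hp
  have h2 := mul_le_mul_of_nonneg_left ha' hq
  have : c = p * c + q * c := by rw [← add_mul, hpq, one_mul]
  linarith

theorem convex_posSemidef {n : ℕ} :
    Convex ℝ {Y : Matrix (Fin n) (Fin n) ℝ | Y.PosSemidef} := by
  intro X hX Y hY p q hp hq _
  exact (hX.smul hp).add (hY.smul hq)

/-- Weak duality: affine majorants of `Φ_s(·; t)` bound its concave envelope. -/
theorem PhiHat_le_trace {n : ℕ} (s : ℕ) (t : ℝ) {W : Matrix (Fin n) (Fin n) ℝ} (hW : Wᵀ * W = 1)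
    {z : Fin n → ℝ} (hz : ∀ i, 0 < z i) (hm : Monotone z) (X : Matrix (Fin n) (Fin n) ℝ) :
    PhiHat s t X ≤ (((W * Matrix.diagonal z * Wᵀ * X).trace + dualConst s t z : ℝ) : EReal) := by
  refine concaveEnvelope_le_of_affine convex_posSemidef
    ((Matrix.traceLinearMap (Fin n) ℝ ℝ).comp (LinearMap.mulLeft ℝ (W * Matrix.diagonal z * Wᵀ)))
    (dualConst s t z) (fun Y hY => (Phi_le_sum s t hY hz).trans ?_) X
  rw [EReal.coe_le_coe_iff]
  exact add_le_add_left (sum_mul_sortedEigenvalues_le_trace hW hY.isHermitian hm) _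

theorem trace_conj_diagonal_mul_conj {n : ℕ} {W : Matrix (Fin n) (Fin n) ℝ} (hW : Wᵀ * W = 1)
    (z y : Fin n → ℝ) :
    (W * Matrix.diagonal z * Wᵀ * (W * Matrix.diagonal y * Wᵀ)).trace = ∑ i, z i * y i := by
  rw [trace_conj_diagonal_mul]
  have : Wᵀ * (W * Matrix.diagonal y * Wᵀ) * W = Matrix.diagonal y := by
    rw [mul_assoc, mul_assoc (W * _), hW, mul_one, ← mul_assoc, hW, one_mul]
  simp [this]

/-- Weak duality in terms of the eigenvalues. -/
theorem PhiHat_le_sum {n : ℕ} (s : ℕ) (t : ℝ) {z : Fin n → ℝ} (hz : ∀ i, 0 < z i)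
    (hm : Monotone z) {X : Matrix (Fin n) (Fin n) ℝ} (hX : X.IsHermitian) :
    PhiHat s t X ≤ ((∑ i, z i * sortedEigenvalues X i + dualConst s t z : ℝ) : EReal) := by
  obtain ⟨V, hV1, hV2, hV⟩ := exists_orthogonal_eq_conj_diagonal hX
  have := PhiHat_le_trace s t hV1 hz hm X
  rwa [show (V * Matrix.diagonal z * Vᵀ * X).trace = ∑ i, z i * sortedEigenvalues X i by
    conv_lhs => rw [hV]
    exact trace_conj_diagonal_mul_conj hV1 _ _] at this

/-! ### Lower bounds for the envelope from the hypersimplex. -/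

theorem sum_le_sum_of_antitone {n s : ℕ} (hsn : s ≤ n) {f : Fin n → EReal} (hf : Antitone f)
    {S : Finset (Fin n)} (hS : S.card = s) :
    ∑ i ∈ S, f i ≤ ∑ i : Fin n with i.val < s, f i := by
  classical
  set B : Finset (Fin n) := Finset.univ.filter (fun i => i.val < s) with hB
  have hBc : B.card = s := by
    rw [hB, Fin.card_filter_val_lt, min_eq_right hsn]
  rcases Nat.eq_zero_or_pos s with rfl | hs
  · rw [Finset.card_eq_zero.mp hS, Finset.card_eq_zero.mp hBc]
  -- `c` separates the values: at most `c` on `S \ B`, at least `c` on `B \ S`, and these sets have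
  -- equal size.
  set c := f ⟨s - 1, by omega⟩ with hc
  rw [← Finset.sum_inter_add_sum_sdiff S B, ← Finset.sum_inter_add_sum_sdiff B S,
    Finset.inter_comm B S]
  refine add_le_add_right ?_ _
  have hcard : (S \ B).card = (B \ S).card := Finset.card_sdiff_comm (hS.trans hBc.symm)
  calc ∑ i ∈ S \ B, f i ≤ (S \ B).card • c := Finset.sum_le_card_nsmul _ _ _ fun i hi => by
        refine hf ?_
        rw [Fin.le_def]
        simp [hB] at hi
        simp; omega
    _ = (B \ S).card • c := by rw [hcard]
    _ ≤ ∑ i ∈ B \ S, f i := Finset.card_nsmul_le_sum _ _ _ fun i hi => by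
        refine hf ?_
        rw [Fin.le_def]
        simp [hB] at hi
        simp; omega

theorem sum_log_le_Phi {n s : ℕ} (hsn : s ≤ n) (t : ℝ) {W : Matrix (Fin n) (Fin n) ℝ}
    (hW : Wᵀ * W = 1) (y : Fin n → ℝ) {S : Finset (Fin n)} (hS : S.card = s) :
    ∑ i ∈ S, ENNReal.log (ENNReal.ofReal (y i + t)) ≤
      Phi s t (W * Matrix.diagonal y * Wᵀ) := by
  obtain ⟨σ, hσ⟩ := exists_perm_sortedEigenvalues_conj_diagonal hW y
  have : ∑ i ∈ S, ENNReal.log (ENNReal.ofReal (y i + t)) =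
      ∑ i ∈ S.map σ.toEmbedding, ENNReal.log (ENNReal.ofReal
        (sortedEigenvalues (W * Matrix.diagonal y * Wᵀ) i + t)) := by
    rw [Finset.sum_map]
    exact Finset.sum_congr rfl fun i _ => by rw [hσ i]; rfl
  rw [this]
  refine sum_le_sum_of_antitone hsn (fun i j hij => ?_) (by rwa [Finset.card_map])
  exact ENNReal.log_le_log (ENNReal.ofReal_le_ofReal
    (add_le_add_left (sortedEigenvalues_antitone _ hij) _))

/-- The hypersimplex is the convex hull of its `0`-`1` points. -/
theorem mem_of_convex_of_hypersimplex {n s : ℕ} (hsn : s ≤ n) {K : Set (Fin n → ℝ)}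
    (hK : Convex ℝ K)
    (hv : ∀ S : Finset (Fin n), S.card = s → (fun i => if i ∈ S then (1 : ℝ) else 0) ∈ K)
    {p : Fin n → ℝ} (hp : ∀ i, p i ∈ Set.Icc (0 : ℝ) 1) (hs : ∑ i, p i = s) : p ∈ K := by
  have hcard : ((Finset.univ.filter (fun j : Fin n => j.val < s)).card : ℝ) = s := by
    rw [Fin.card_filter_val_lt, min_eq_right hsn]
  have hcard' : ((Finset.univ.filter (fun j : Fin n => ¬ j.val < s)).card : ℝ) = n - s := by
    have := Finset.card_filter_add_card_filter_not (s := Finset.univ) (fun j : Fin n => j.val < s)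
    have h2 : ((Finset.univ.filter (fun j : Fin n => j.val < s)).card : ℝ) +
      (Finset.univ.filter (fun j : Fin n => ¬ j.val < s)).card = n := by
      rw [← Nat.cast_add, this]; simp
    linarith
  have hp0 : (s : ℝ) = 0 → ∀ i, p i = 0 := fun h i => by
    rw [h] at hs
    exact (Finset.sum_eq_zero_iff_of_nonneg fun i _ => (hp i).1).mp hs i (Finset.mem_univ i)
  have hq : ∑ i, (1 - p i) = n - s := by simp [hs]
  have hp1 : (n : ℝ) - s = 0 → ∀ i, 1 - p i = 0 := fun h i => by
    rw [h] at hq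
    exact (Finset.sum_eq_zero_iff_of_nonneg fun i _ => sub_nonneg.mpr (hp i).2).mp hq i
      (Finset.mem_univ i)
  have hns : (0 : ℝ) ≤ n - s := sub_nonneg.mpr (by exact_mod_cast hsn)
  -- The first `s` columns are multiples of `p` and sum to `p`. Birkhoff then writes `p` as an
  -- average of permuted copies of the indicator of `j < s`.
  set P : Matrix (Fin n) (Fin n) ℝ := Matrix.of fun i j =>
    if j.val < s then p i / s else (1 - p i) / (n - s) with hP
  have hsum1 : ∀ i, ∑ j : Fin n with j.val < s, P i j = p i := fun i => by
    rw [Finset.sum_congr rfl (g := fun _ => p i / s)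
      fun j hj => by simp [hP, (Finset.mem_filter.mp hj).2], Finset.sum_const, nsmul_eq_mul, hcard]
    by_cases h : (s : ℝ) = 0
    · simp [hp0 h i]
    · field_simp
  have hmem : P ∈ doublyStochastic ℝ (Fin n) := by
    rw [mem_doublyStochastic_iff_sum]
    refine ⟨fun i j => ?_, fun i => ?_, fun j => ?_⟩
    · simp only [hP, Matrix.of_apply]
      split_ifs
      · exact div_nonneg (hp i).1 (Nat.cast_nonneg s)
      · exact div_nonneg (sub_nonneg.mpr (hp i).2) hns
    · rw [← Finset.sum_filter_add_sum_filter_not _ (fun j : Fin n => j.val < s), hsum1 i,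
        Finset.sum_congr rfl (g := fun _ => (1 - p i) / (n - s))
        fun j hj => by simp [hP, (Finset.mem_filter.mp hj).2], Finset.sum_const, nsmul_eq_mul,
        hcard']
      by_cases h : (n : ℝ) - s = 0
      · have := hp1 h i
        simp [this]; linarith
      · field_simp
        ring
    · by_cases h : j.val < s
      · simp only [hP, Matrix.of_apply, h, if_true, ← Finset.sum_div, hs]
        exact div_self (by exact_mod_cast (by omega : s ≠ 0))
      · simp only [hP, Matrix.of_apply, h, if_false, ← Finset.sum_div, hq]
        refine div_self (sub_ne_zero.mpr ?_)
        have := j.2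
        exact_mod_cast (by omega : n ≠ s)
  obtain ⟨w, hw0, hw1, hw⟩ := exists_eq_sum_perm_of_mem_doublyStochastic hmem
  have hpw : p = ∑ σ : Equiv.Perm (Fin n), w σ • fun i => if (σ i).val < s then (1 : ℝ) else 0 := by
    ext i
    rw [← hsum1 i, ← hw, Finset.sum_apply]
    simp_rw [Matrix.sum_apply]
    rw [Finset.sum_comm]
    refine Finset.sum_congr rfl fun σ _ => ?_
    simp [Equiv.Perm.permMatrix, Equiv.toPEquiv_apply, PEquiv.toMatrix_apply, Finset.sum_ite_eq]
  rw [hpw]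
  refine hK.sum_mem (fun σ _ => hw0 σ) hw1 fun σ _ => ?_
  have := hv (Finset.univ.filter fun i => (σ i).val < s) ?_
  · simpa using this
  · rw [← Finset.card_map σ.toEmbedding]
    have e : (Finset.univ.filter fun i => (σ i).val < s).map σ.toEmbedding =
        Finset.univ.filter fun i : Fin n => i.val < s := by
      ext j
      simp only [Finset.mem_map, Finset.mem_filter, Finset.mem_univ, true_and]
      exact ⟨by rintro ⟨i, hi, rfl⟩; exact hi, fun h => ⟨σ.symm j, by simpa using h, by simp⟩⟩
    rw [e, Fin.card_filter_val_lt, min_eq_right hsn]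

/-- Lower bound for the concave envelope at a matrix whose eigenvalues are `p i * v i`, with `p` in
the hypersimplex. -/
theorem sum_mul_log_le_PhiHat {n s : ℕ} (hsn : s ≤ n) (t : ℝ)
    {W : Matrix (Fin n) (Fin n) ℝ} (hW : Wᵀ * W = 1) {p v : Fin n → ℝ}
    (hp : ∀ i, p i ∈ Set.Icc (0 : ℝ) 1) (hs : ∑ i, p i = s) (hv : ∀ i, 0 ≤ v i)
    (hvt : ∀ i, 0 < v i + t) :
    ((∑ i, p i * Real.log (v i + t) : ℝ) : EReal) ≤
      PhiHat s t (W * Matrix.diagonal (fun i => p i * v i) * Wᵀ) := by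
  refine le_sInf ?_
  rintro _ ⟨F, hF, hle, rfl⟩
  -- `L` is linear, so the hypograph of `F` has convex preimage and only `0`-`1` vectors need
  -- checking.
  let L : (Fin n → ℝ) → Matrix (Fin n) (Fin n) ℝ × ℝ := fun q =>
    (W * Matrix.diagonal (fun i => q i * v i) * Wᵀ, ∑ i, q i * Real.log (v i + t))
  have hL : IsLinearMap ℝ L := by
    constructor
    · intro a b
      simp only [L, Pi.add_apply, add_mul, Finset.sum_add_distrib, Prod.mk_add_mk]
      rw [← Matrix.diagonal_add, mul_add, add_mul]
    · intro c a
      simp only [L, Pi.smul_apply, smul_eq_mul, Prod.smul_mk, Finset.mul_sum, mul_assoc c]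
      rw [show (fun i => c * (a i * v i)) = c • fun i => a i * v i from rfl,
        Matrix.diagonal_smul, Matrix.mul_smul, Matrix.smul_mul]
  have := mem_of_convex_of_hypersimplex hsn (hF.is_linear_preimage hL) (fun S hS => ?_) hp hs
  · exact this.2
  have hpos : (W * Matrix.diagonal (fun i => (if i ∈ S then (1 : ℝ) else 0) * v i) * Wᵀ).PosSemidef :=
    posSemidef_conj_diagonal W fun i => mul_nonneg (by split_ifs <;> simp) (hv i)
  refine ⟨hpos, le_trans ?_ (hle _ hpos)⟩
  refine le_trans (le_of_eq ?_) (sum_log_le_Phi hsn t hW _ hS)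
  simp only [L, ite_mul, one_mul, zero_mul, Finset.sum_ite_mem, Finset.univ_inter]
  rw [EReal.coe_sum_real]
  refine Finset.sum_congr rfl fun i hi => ?_
  rw [if_pos hi, ENNReal.log_ofReal_of_pos (hvt i)]

/-! ### Optimal decomposition and strong duality. -/

theorem sum_filter_le_succ {n : ℕ} (f : Fin n → ℝ) (k : ℕ) (hk : k < n) :
    ∑ i : Fin n with k ≤ i.val, f i = f ⟨k, hk⟩ + ∑ i : Fin n with k + 1 ≤ i.val, f i := by
  rw [← Finset.sum_insert (by simp)]
  refine Finset.sum_congr ?_ fun _ _ => rfl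
  ext i
  simp only [Finset.mem_filter, Finset.mem_univ, true_and, Finset.mem_insert, Fin.ext_iff]
  omega

/-- The threshold index of the concave envelope: the `s - k` smallest entries of the optimal
`s`-vector are all equal to `a`. -/
theorem exists_threshold {n s : ℕ} (hs : 1 ≤ s) (hsn : s ≤ n) {μ : Fin n → ℝ} (hμ : Antitone μ)
    (hμ0 : ∀ i, 0 ≤ μ i) :
    ∃ (k : ℕ) (a : ℝ), k < s ∧ 0 ≤ a ∧ (∑ i : Fin n with k ≤ i.val, μ i = (s - k) * a) ∧
      (∀ i : Fin n, k ≤ i.val → μ i ≤ a) ∧ (∀ i : Fin n, i.val < k → a ≤ μ i) := by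
  classical
  -- The least such `k` is the threshold: `P k` says that the average `a` dominates the tail, and
  -- failure of `P (k - 1)` gives `a < μ (k - 1)`.
  let P : ℕ → Prop := fun k => ∃ h : k < n,
    ((s : ℝ) - k) * μ ⟨k, h⟩ ≤ ∑ i : Fin n with k ≤ i.val, μ i
  have hP : P (s - 1) := by
    refine ⟨by omega, ?_⟩
    rw [sum_filter_le_succ μ (s - 1) (by omega), Nat.cast_sub hs]
    have : 0 ≤ ∑ i : Fin n with s - 1 + 1 ≤ i.val, μ i := Finset.sum_nonneg fun i _ => hμ0 i
    push_cast
    linarith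
  have hex : ∃ k, P k := ⟨_, hP⟩
  obtain ⟨hkn, hk⟩ := Nat.find_spec hex
  set k := Nat.find hex with hkdef
  have hks : k < s := lt_of_le_of_lt (Nat.find_min' hex hP) (by omega)
  have hpos : (0 : ℝ) < s - k := sub_pos.mpr (by exact_mod_cast hks)
  refine ⟨k, (∑ i : Fin n with k ≤ i.val, μ i) / (s - k), hks,
    div_nonneg (Finset.sum_nonneg fun i _ => hμ0 i) hpos.le, by field_simp, fun i hi => ?_,
    fun i hi => ?_⟩
  · rw [le_div_iff₀ hpos, mul_comm]
    exact (mul_le_mul_of_nonneg_left (hμ (show (⟨k, hkn⟩ : Fin n) ≤ i from hi)) hpos.le).trans hk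
  · have hmin : ¬ P (k - 1) := Nat.find_min hex (by omega)
    have h1 : k - 1 < n := by omega
    have h2 : ∑ i : Fin n with k - 1 ≤ i.val, μ i < ((s : ℝ) - (k - 1 : ℕ)) * μ ⟨k - 1, h1⟩ := by
      by_contra hc
      exact hmin ⟨h1, not_lt.mp hc⟩
    rw [sum_filter_le_succ μ (k - 1) h1, Nat.cast_sub (by omega), Nat.sub_add_cancel (by omega)]
      at h2
    push_cast at h2
    rw [div_le_iff₀ hpos]
    have h3 : μ ⟨k - 1, h1⟩ ≤ μ i := hμ (by rw [Fin.le_def]; simp; omega)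
    have := mul_le_mul_of_nonneg_left h3 hpos.le
    linarith

/-- The optimal decomposition `μ = p * v` of a vector of eigenvalues, with `p` in the
hypersimplex. -/
theorem exists_optimal_decomposition {n s : ℕ} (hs : 1 ≤ s) (hsn : s ≤ n) {μ : Fin n → ℝ}
    (hμ : Antitone μ) (hμ0 : ∀ i, 0 ≤ μ i) :
    ∃ p v : Fin n → ℝ, (∀ i, p i ∈ Set.Icc (0 : ℝ) 1) ∧ ∑ i, p i = s ∧ (∀ i, 0 ≤ v i) ∧
      Antitone v ∧ (∀ i, μ i = p i * v i) ∧ (∀ i, v ⟨s - 1, by omega⟩ ≤ v i) ∧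
      ∀ g : ℝ → ℝ, ∑ i, p i * g (v i) = ∑ i : Fin n with i.val < s, g (v i) := by
  obtain ⟨k, a, hks, ha, hsum, hle, hge⟩ := exists_threshold hs hsn hμ hμ0
  let v : Fin n → ℝ := fun i => max (μ i) a
  have hv1 : ∀ i : Fin n, i.val < k → v i = μ i := fun i hi => max_eq_left (hge i hi)
  have hv2 : ∀ i : Fin n, k ≤ i.val → v i = a := fun i hi => max_eq_right (hle i hi)
  have hcard : ((Finset.univ.filter fun i : Fin n => k ≤ i.val ∧ i.val < s).card : ℝ) = s - k := by
    have h1 : (Finset.univ.filter fun i : Fin n => i.val < s).card = s := by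
      rw [Fin.card_filter_val_lt, min_eq_right hsn]
    have h2 : (Finset.univ.filter fun i : Fin n => i.val < k).card = k := by
      rw [Fin.card_filter_val_lt, min_eq_right (by omega)]
    have h3 : (Finset.univ.filter fun i : Fin n => i.val < s) =
        (Finset.univ.filter fun i : Fin n => i.val < k) ∪
        (Finset.univ.filter fun i : Fin n => k ≤ i.val ∧ i.val < s) := by
      ext i; simp; omega
    rw [h3, Finset.card_union_of_disjoint, h2] at h1
    · rw [eq_sub_iff_add_eq', ← Nat.cast_add, h1]
    · rw [Finset.disjoint_filter]; intros; omega
  obtain ⟨q, hq01, hqs, hqa⟩ : ∃ q : Fin n → ℝ, (∀ i, k ≤ i.val → q i ∈ Set.Icc (0 : ℝ) 1) ∧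
      (∑ i : Fin n with k ≤ i.val, q i = s - k) ∧ ∀ i, k ≤ i.val → μ i = q i * a := by
    rcases ha.eq_or_lt with h0 | h0
    -- If `a = 0` the tail of `μ` vanishes, so any weights in `[0,1]` with sum `s - k` serve.
    · refine ⟨fun i => if i.val < s then 1 else 0, fun i _ => by dsimp only; split_ifs <;> simp,
        ?_, fun i hi => ?_⟩
      · rw [Finset.sum_ite, Finset.sum_const_zero, add_zero, Finset.sum_const, nsmul_eq_mul,
          mul_one, Finset.filter_filter, hcard]
      · rw [← h0, mul_zero]
        exact le_antisymm (h0 ▸ hle i hi) (hμ0 i)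
    · refine ⟨fun i => μ i / a, fun i hi => ⟨div_nonneg (hμ0 i) ha, (div_le_one h0).mpr (hle i hi)⟩,
        ?_, fun i _ => by field_simp⟩
      rw [← Finset.sum_div, hsum]
      field_simp
  let p : Fin n → ℝ := fun i => if i.val < k then 1 else q i
  have hpg : ∀ g : ℝ → ℝ, ∑ i, p i * g (v i) = ∑ i : Fin n with i.val < s, g (v i) := by
    intro g
    rw [← Finset.sum_filter_add_sum_filter_not _ (fun i : Fin n => i.val < k),
      ← Finset.sum_filter_add_sum_filter_not (Finset.univ.filter fun i : Fin n => i.val < s)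
        (fun i : Fin n => i.val < k), Finset.filter_filter, Finset.filter_filter]
    congr 1
    · refine Finset.sum_congr ?_ fun i hi => ?_
      · ext i; simp; omega
      · simp only [Finset.mem_filter, Finset.mem_univ, true_and] at hi
        simp [p, hi.2]
    · rw [Finset.sum_congr rfl (g := fun i => q i * g a) fun i hi => by
          simp only [Finset.mem_filter, Finset.mem_univ, true_and] at hi
          simp only [p, hi, if_false, hv2 i (not_lt.mp hi)],
        Finset.sum_congr (s₁ := Finset.univ.filter fun i : Fin n => i.val < s ∧ ¬ i.val < k)
          rfl (g := fun _ => g a) fun i hi => by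
          simp only [Finset.mem_filter, Finset.mem_univ, true_and] at hi
          rw [hv2 i (not_lt.mp hi.2)],
        ← Finset.sum_mul, Finset.sum_const, nsmul_eq_mul]
      congr 1
      simp only [not_lt]
      rw [hqs, ← hcard]
      simp only [and_comm]
  refine ⟨p, v, fun i => ?_, ?_, fun i => ha.trans (le_max_right _ _),
    fun i j hij => max_le_max (hμ hij) le_rfl, fun i => ?_, fun i => ?_, hpg⟩
  · by_cases h : i.val < k
    · simp [p, h]
    · simpa [p, h] using hq01 i (not_lt.mp h)
  · have := hpg fun _ => 1
    simp only [mul_one, Finset.sum_const, nsmul_eq_mul, Fin.card_filter_val_lt,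
      min_eq_right hsn] at this
    exact this
  · by_cases h : i.val < k
    · simp [p, h, hv1 i h]
    · simpa [p, h, hv2 i (not_lt.mp h)] using hqa i (not_lt.mp h)
  · rw [hv2 _ (by simp; omega)]
    exact le_max_right _ _

/-- Each term on the left falls short of its logarithm by `ε / (v i + t + ε)`, so `ε = 0` gives
equality. -/
theorem dual_value_le {n s : ℕ} {t ε : ℝ} (hε : 0 ≤ ε) {p v : Fin n → ℝ}
    (hv : ∀ i, 0 < v i + t + ε)
    (hg : ∀ g : ℝ → ℝ, ∑ i, p i * g (v i) = ∑ i : Fin n with i.val < s, g (v i)) :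
    ∑ i, (v i + t + ε)⁻¹ * (p i * v i) + dualConst s t (fun i => (v i + t + ε)⁻¹) ≤
      ∑ i : Fin n with i.val < s, Real.log (v i + t + ε) := by
  have h1 : ∑ i, (v i + t + ε)⁻¹ * (p i * v i) =
      ∑ i : Fin n with i.val < s, (v i + t + ε)⁻¹ * v i := by
    rw [← hg fun x => (x + t + ε)⁻¹ * x]
    exact Finset.sum_congr rfl fun i _ => by ring
  rw [h1, dualConst, ← Finset.sum_add_distrib]
  refine Finset.sum_le_sum fun i _ => ?_
  rw [Real.log_inv]
  have h2 : (v i + t + ε)⁻¹ * (v i + t + ε) = 1 := inv_mul_cancel₀ (hv i).ne'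
  have h3 : 0 ≤ (v i + t + ε)⁻¹ * ε := mul_nonneg (inv_nonneg.mpr (hv i).le) hε
  linarith

/-- Strong duality for the concave envelope of `Φ_s(·; t)`. -/
theorem exists_dual_lt {n s : ℕ} (hs : 1 ≤ s) (hsn : s ≤ n) {t : ℝ} (ht : 0 ≤ t)
    {X : Matrix (Fin n) (Fin n) ℝ} (hX : X.PosSemidef) {r : ℝ} (hr : PhiHat s t X < r) :
    ∃ z : Fin n → ℝ, (∀ i, 0 < z i) ∧ Monotone z ∧
      ∑ i, z i * sortedEigenvalues X i + dualConst s t z < r := by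
  obtain ⟨W, hW1, hW2, hW⟩ := exists_orthogonal_eq_conj_diagonal hX.isHermitian
  obtain ⟨p, v, hp, hps, hv0, hva, hμ, hvs, hg⟩ := exists_optimal_decomposition hs hsn
    (sortedEigenvalues_antitone X) (sortedEigenvalues_nonneg hX)
  have key : ∀ ε : ℝ, 0 ≤ ε → (∀ i, 0 < v i + t + ε) →
      ∑ i : Fin n with i.val < s, Real.log (v i + t + ε) < r →
      ∃ z : Fin n → ℝ, (∀ i, 0 < z i) ∧ Monotone z ∧
        ∑ i, z i * sortedEigenvalues X i + dualConst s t z < r := by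
    intro ε hε hpos hlt
    refine ⟨fun i => (v i + t + ε)⁻¹, fun i => inv_pos.mpr (hpos i), fun i j hij => ?_, ?_⟩
    · exact inv_anti₀ (hpos j) (by linarith [hva hij])
    · simp only [hμ]
      exact (dual_value_le hε hpos hg).trans_lt hlt
  have hs1 : s - 1 < n := by omega
  rcases (add_nonneg (hv0 ⟨s - 1, hs1⟩) ht).eq_or_lt with h0 | h0
  -- The primal value degenerates to `-∞`. The term at `s - 1` is `log ε`; since `ε ≤ 1` the others
  -- total at most `c`, so this `ε` brings the sum to `r - 1` or below.
  · set B : Finset (Fin n) := Finset.univ.filter fun i => i.val < s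
    have hB : (⟨s - 1, hs1⟩ : Fin n) ∈ B := by simp [B]; omega
    set c := ∑ i ∈ B.erase ⟨s - 1, hs1⟩, Real.log (v i + t + 1) with hc
    set ε := min 1 (Real.exp (r - c - 1)) with hε
    have hε0 : 0 < ε := lt_min one_pos (Real.exp_pos _)
    have hpos : ∀ i, 0 < v i + t + ε := fun i => by linarith [hv0 i]
    refine key ε hε0.le hpos ?_
    rw [← Finset.add_sum_erase _ _ hB, ← h0, zero_add]
    have h1 : Real.log ε ≤ r - c - 1 := by
      rw [Real.log_le_iff_le_exp hε0]
      exact min_le_right _ _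
    have h2 : ∑ i ∈ B.erase ⟨s - 1, hs1⟩, Real.log (v i + t + ε) ≤ c :=
      Finset.sum_le_sum fun i _ => Real.log_le_log (hpos i) (by linarith [min_le_left 1 (Real.exp (r - c - 1))])
    linarith
  · have hpos : ∀ i, 0 < v i + t := fun i => by linarith [hvs i]
    refine key 0 le_rfl (by simpa using hpos) ?_
    have := sum_mul_log_le_PhiHat hsn t hW1 hp hps hv0 hpos
    simp only [← hμ] at this
    rw [← hW, hg fun x => Real.log (x + t)] at this
    simpa using EReal.coe_lt_coe_iff.mp (this.trans_lt hr)

/-! ### Finiteness and attainment. -/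

theorem bot_lt_PhiHat {n s : ℕ} (hs : 1 ≤ s) (hsn : s ≤ n) {t : ℝ} (ht : 0 < t)
    {X : Matrix (Fin n) (Fin n) ℝ} (hX : X.PosSemidef) : ⊥ < PhiHat s t X := by
  obtain ⟨W, hW1, hW2, hW⟩ := exists_orthogonal_eq_conj_diagonal hX.isHermitian
  obtain ⟨p, v, hp, hps, hv0, hva, hμ, hvs, hg⟩ := exists_optimal_decomposition hs hsn
    (sortedEigenvalues_antitone X) (sortedEigenvalues_nonneg hX)
  have := sum_mul_log_le_PhiHat hsn t hW1 hp hps hv0 fun i => by linarith [hv0 i]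
  simp only [← hμ] at this
  rw [← hW] at this
  exact (EReal.bot_lt_coe _).trans_le this

theorem PhiHat_lt_top {n s : ℕ} (t : ℝ) {X : Matrix (Fin n) (Fin n) ℝ} (hX : X.IsHermitian) :
    PhiHat s t X < ⊤ :=
  (PhiHat_le_sum s t (z := fun _ => 1) (fun _ => one_pos) monotone_const hX).trans_lt
    (EReal.coe_lt_top _)

theorem weightedGram_eq {n : ℕ} (A : Matrix (Fin n) (Fin n) ℝ) (x : Fin n → ℝ) :
    weightedGram A x = A * Matrix.diagonal x * Aᵀ := by
  ext i j
  rw [Matrix.mul_apply]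
  simp only [weightedGram, Matrix.sum_apply, Matrix.smul_apply, Matrix.vecMulVec_apply,
    Matrix.col_apply, smul_eq_mul, Matrix.mul_diagonal, Matrix.transpose_apply]
  exact Finset.sum_congr rfl fun k _ => by ring

theorem posSemidef_weightedGram {n : ℕ} (A : Matrix (Fin n) (Fin n) ℝ) {x : Fin n → ℝ}
    (hx : ∀ i, 0 ≤ x i) : (weightedGram A x).PosSemidef := by
  rw [weightedGram_eq]
  exact posSemidef_conj_diagonal A hx

/-- The feasible set of the relaxation. -/
def hypersimplex (n s : ℕ) : Set (Fin n → ℝ) :=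
  {x | (∀ i, x i ∈ Set.Icc (0 : ℝ) 1) ∧ ∑ i, x i = (s : ℝ)}

theorem isCompact_hypersimplex (n s : ℕ) : IsCompact (hypersimplex n s) := by
  have h1 : IsCompact (Set.univ.pi fun _ : Fin n => Set.Icc (0 : ℝ) 1) :=
    isCompact_univ_pi fun _ => isCompact_Icc
  have h2 : IsClosed {x : Fin n → ℝ | ∑ i, x i = (s : ℝ)} :=
    isClosed_eq (by fun_prop) continuous_const
  convert h1.inter_right h2 using 1
  ext x
  simp only [hypersimplex, Set.mem_ofPred_eq, Set.mem_inter_iff, Set.mem_univ_pi]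

theorem hypersimplex_nonempty {n s : ℕ} (hsn : s ≤ n) : (hypersimplex n s).Nonempty := by
  refine ⟨fun i => if i.val < s then 1 else 0, fun i => ?_, ?_⟩
  · dsimp only
    split_ifs <;> simp
  · rw [Finset.sum_boole, Fin.card_filter_val_lt, min_eq_right hsn]

/-- A single affine majorant that is below `r` at `x` stays below `r` nearby, by continuity. -/
theorem upperSemicontinuousOn_PhiHat_weightedGram {n s : ℕ} (hs : 1 ≤ s) (hsn : s ≤ n) {t : ℝ}
    (ht : 0 ≤ t) (A : Matrix (Fin n) (Fin n) ℝ) :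
    UpperSemicontinuousOn (fun x => PhiHat s t (weightedGram A x)) (hypersimplex n s) := by
  intro x hx y hy
  obtain ⟨r, hr1, hr2⟩ := EReal.lt_iff_exists_real_btwn.mp hy
  have hX := posSemidef_weightedGram A fun i => (hx.1 i).1
  obtain ⟨z, hz0, hzm, hz⟩ := exists_dual_lt hs hsn ht hX hr1
  obtain ⟨W, hW1, hW2, hW⟩ := exists_orthogonal_eq_conj_diagonal hX.isHermitian
  have hcont : Continuous fun x' : Fin n → ℝ =>
      (W * Matrix.diagonal z * Wᵀ * weightedGram A x').trace + dualConst s t z := by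
    unfold weightedGram
    fun_prop
  have hlt : (W * Matrix.diagonal z * Wᵀ * weightedGram A x).trace + dualConst s t z < r := by
    rwa [show (W * Matrix.diagonal z * Wᵀ * weightedGram A x).trace =
        ∑ i, z i * sortedEigenvalues (weightedGram A x) i by
      conv_lhs => rw [hW]
      exact trace_conj_diagonal_mul_conj hW1 _ _]
  filter_upwards [mem_nhdsWithin_of_mem_nhds (hcont.continuousAt.eventually_lt_const hlt)]
    with x' hx'
  exact (PhiHat_le_trace s t hW1 hz0 hzm _).trans_lt
    ((EReal.coe_lt_coe_iff.mpr hx').trans hr2)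

theorem exists_max_PhiHat {n s : ℕ} (hs : 1 ≤ s) (hsn : s ≤ n) {t : ℝ}
    (ht : 0 ≤ t) (A : Matrix (Fin n) (Fin n) ℝ) :
    ∃ x ∈ hypersimplex n s, IsGreatest (augFactValues s t A) (PhiHat s t (weightedGram A x)) := by
  obtain ⟨x, hx, hmax⟩ := (upperSemicontinuousOn_PhiHat_weightedGram hs hsn ht A).exists_isMaxOn
    (hypersimplex_nonempty hsn) (isCompact_hypersimplex n s)
  refine ⟨x, hx, ⟨x, hx.1, hx.2, rfl⟩, ?_⟩
  rintro _ ⟨y, hy1, hy2, rfl⟩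
  exact hmax (show y ∈ hypersimplex n s from ⟨hy1, hy2⟩)

/-! ### Comparison of the two bounds. -/

/-- Swapping the factors `A √D` and `√D Aᵀ` leaves only the Gram matrix `Aᵀ * A`, so the spectrum
does not depend on the choice of factor. -/
theorem charpoly_weightedGram {n : ℕ} (A : Matrix (Fin n) (Fin n) ℝ) {x : Fin n → ℝ}
    (hx : ∀ i, 0 ≤ x i) :
    (weightedGram A x).charpoly = (Matrix.diagonal (fun i => √(x i)) * (Aᵀ * A) *
      Matrix.diagonal (fun i => √(x i))).charpoly := by
  have : Matrix.diagonal x = Matrix.diagonal (fun i => √(x i)) *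
      Matrix.diagonal (fun i => √(x i)) := by
    rw [Matrix.diagonal_mul_diagonal]
    congr 1
    exact funext fun i => (Real.mul_self_sqrt (hx i)).symm
  rw [weightedGram_eq, this, ← mul_assoc, mul_assoc (A * _), Matrix.charpoly_mul_comm]
  simp only [mul_assoc]

/-- Ky Fan's inequality against a matrix with diagonal in the hypersimplex. -/
theorem sum_le_trace_diagonal {n s : ℕ} (hs : 1 ≤ s) (hsn : s ≤ n)
    {W : Matrix (Fin n) (Fin n) ℝ} (hW : Wᵀ * W = 1) {z x : Fin n → ℝ} (hz : Monotone z)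
    (hx : x ∈ hypersimplex n s) :
    ∑ i : Fin n with i.val < s, z i ≤
      (W * Matrix.diagonal z * Wᵀ * Matrix.diagonal x).trace := by
  rw [trace_conj_diagonal_mul]
  set d : Fin n → ℝ := fun i => (Wᵀ * Matrix.diagonal x * W) i i with hd
  have hW' : W * Wᵀ = 1 := mul_eq_one_comm.mp hW
  have hdi : ∀ i, d i = ∑ j, W j i ^ 2 * x j := fun i => by
    simp only [hd]
    rw [Matrix.mul_apply]
    simp only [Matrix.mul_diagonal, Matrix.transpose_apply]
    exact Finset.sum_congr rfl fun j _ => by ring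
  have hcol : ∀ i, ∑ j, W j i ^ 2 = 1 := fun i => by
    simpa using sum_sq_orthogonal (Q := Wᵀ) (by simpa using hW) i
  have hd0 : ∀ i, 0 ≤ d i := fun i => by
    rw [hdi]
    exact Finset.sum_nonneg fun j _ => mul_nonneg (sq_nonneg _) (hx.1 j).1
  have hd1 : ∀ i, d i ≤ 1 := fun i => by
    rw [hdi, ← hcol i]
    exact Finset.sum_le_sum fun j _ => mul_le_of_le_one_right (sq_nonneg _) (hx.1 j).2
  have hds : ∑ i, d i = s := by
    simp_rw [hdi]
    rw [Finset.sum_comm, ← hx.2]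
    refine Finset.sum_congr rfl fun j _ => ?_
    rw [← Finset.sum_mul, sum_sq_orthogonal hW' j, one_mul]
  have hs1 : s - 1 < n := by omega
  set c := z ⟨s - 1, hs1⟩ with hc
  -- Subtracting `c` fixes the sign of each term; it costs `c * s` on both sides because `d` also
  -- sums to `s`.
  have hterm : ∀ i : Fin n, (if i.val < s then z i - c else 0) ≤ (z i - c) * d i := fun i => by
    split_ifs with h
    · have : z i ≤ c := hz (by rw [Fin.le_def]; simp; omega)
      nlinarith [hd1 i]
    · have : c ≤ z i := hz (by rw [Fin.le_def]; simp; omega)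
      exact mul_nonneg (sub_nonneg.mpr this) (hd0 i)
  have hsum := Finset.sum_le_sum fun i (_ : i ∈ Finset.univ) => hterm i
  rw [← Finset.sum_filter, Finset.sum_sub_distrib, Finset.sum_const, nsmul_eq_mul,
    Fin.card_filter_val_lt, min_eq_right hsn] at hsum
  simp only [sub_mul, Finset.sum_sub_distrib, ← Finset.mul_sum, hds] at hsum
  linarith

theorem dualConst_eq_add {n : ℕ} (s : ℕ) (t : ℝ) (z : Fin n → ℝ) :
    dualConst s t z = dualConst s 0 z + t * ∑ i : Fin n with i.val < s, z i := by
  rw [dualConst, dualConst, Finset.mul_sum, ← Finset.sum_add_distrib]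
  exact Finset.sum_congr rfl fun i _ => by ring

theorem PhiHat_weightedGram_le {n s : ℕ} (hs : 1 ≤ s) (hsn : s ≤ n)
    {C A₀ Aₜ : Matrix (Fin n) (Fin n) ℝ} {t : ℝ} (ht : 0 ≤ t) (hA₀ : IsFactor C 0 A₀)
    (hAₜ : IsFactor C t Aₜ) {x : Fin n → ℝ} (hx : x ∈ hypersimplex n s) :
    PhiHat s t (weightedGram Aₜ x) ≤ PhiHat s 0 (weightedGram A₀ x) := by
  by_contra! hlt
  obtain ⟨r, hr1, hr2⟩ := EReal.lt_iff_exists_real_btwn.mp hlt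
  have hx0 : ∀ i, 0 ≤ x i := fun i => (hx.1 i).1
  have hX₀ := posSemidef_weightedGram A₀ hx0
  have hXₜ := posSemidef_weightedGram Aₜ hx0
  obtain ⟨z, hz0, hzm, hz⟩ := exists_dual_lt hs hsn le_rfl hX₀ hr1
  set R : Matrix (Fin n) (Fin n) ℝ := Matrix.diagonal fun i => √(x i) with hR
  have hRR : R * R = Matrix.diagonal x := by
    rw [hR, Matrix.diagonal_mul_diagonal]
    congr 1
    exact funext fun i => Real.mul_self_sqrt (hx0 i)
  have hherm : ∀ A : Matrix (Fin n) (Fin n) ℝ, (R * (Aᵀ * A) * R).IsHermitian := fun A => by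
    simp [Matrix.IsHermitian, hR, mul_assoc, Matrix.conjTranspose_eq_transpose_of_trivial]
  have hM : sortedEigenvalues (weightedGram A₀ x) = sortedEigenvalues (R * (A₀ᵀ * A₀) * R) :=
    sortedEigenvalues_congr hX₀.isHermitian (hherm A₀) (charpoly_weightedGram A₀ hx0)
  have hN : sortedEigenvalues (weightedGram Aₜ x) = sortedEigenvalues (R * (Aₜᵀ * Aₜ) * R) :=
    sortedEigenvalues_congr hXₜ.isHermitian (hherm Aₜ) (charpoly_weightedGram Aₜ hx0)
  have hNM : R * (Aₜᵀ * Aₜ) * R = R * (A₀ᵀ * A₀) * R - t • Matrix.diagonal x := by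
    rw [← hA₀, ← hAₜ, ← hRR]
    simp [mul_sub, sub_mul]
  obtain ⟨W, hW1, hW2, hW⟩ := exists_orthogonal_eq_conj_diagonal (hherm A₀)
  have h1 := PhiHat_le_sum s t hz0 hzm hXₜ.isHermitian
  have h2 := EReal.coe_lt_coe_iff.mp (hr2.trans_le h1)
  have h3 := sum_mul_sortedEigenvalues_le_trace hW1 (hherm Aₜ) hzm
  have h4 : (W * Matrix.diagonal z * Wᵀ * (R * (A₀ᵀ * A₀) * R)).trace =
      ∑ i, z i * sortedEigenvalues (R * (A₀ᵀ * A₀) * R) i := by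
    conv_lhs => rw [hW]
    exact trace_conj_diagonal_mul_conj hW1 _ _
  have h5 := mul_le_mul_of_nonneg_left (sum_le_trace_diagonal hs hsn hW1 hzm hx) ht
  rw [hNM, mul_sub, Matrix.trace_sub, h4, Matrix.mul_smul, Matrix.trace_smul, smul_eq_mul,
    ← hNM, ← hN, ← hM] at h3
  rw [dualConst_eq_add] at h2
  linarith

theorem theorem2 {n s : ℕ} (hs : 1 ≤ s) (hsn : s ≤ n)
    (C : Matrix (Fin n) (Fin n) ℝ) (hC : C.PosDef)
    (t : ℝ) (ht : 0 < t) (htC : t ≤ ⨅ i, hC.isHermitian.eigenvalues i)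
    (A₀ Aₜ : Matrix (Fin n) (Fin n) ℝ) (hA₀ : IsFactor C 0 A₀) (hAₜ : IsFactor C t Aₜ) :
    ∃ z₀ zₜ : ℝ, IsGreatest (augFactValues s 0 A₀) (z₀ : EReal) ∧
      IsGreatest (augFactValues s t Aₜ) (zₜ : EReal) ∧ z₀ ≥ zₜ := by
  obtain ⟨x₀, hx₀, hmax₀⟩ := exists_max_PhiHat hs hsn le_rfl A₀
  obtain ⟨xₜ, hxₜ, hmaxₜ⟩ := exists_max_PhiHat hs hsn ht.le Aₜ
  have hX₀ := posSemidef_weightedGram A₀ fun i => (hx₀.1 i).1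
  have hXₜ := posSemidef_weightedGram Aₜ fun i => (hxₜ.1 i).1
  have hle : PhiHat s t (weightedGram Aₜ xₜ) ≤ PhiHat s 0 (weightedGram A₀ x₀) :=
    (PhiHat_weightedGram_le hs hsn ht.le hA₀ hAₜ hxₜ).trans
      (hmax₀.2 ⟨xₜ, hxₜ.1, hxₜ.2, rfl⟩)
  -- Only `t > 0` excludes `-∞` directly; finiteness at `0` is inherited through `hle`.
  have hbot := bot_lt_PhiHat hs hsn ht hXₜ
  lift PhiHat s t (weightedGram Aₜ xₜ) to ℝ using
    ⟨(PhiHat_lt_top t hXₜ.isHermitian).ne, hbot.ne'⟩ with zₜ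
  lift PhiHat s 0 (weightedGram A₀ x₀) to ℝ using
    ⟨(PhiHat_lt_top 0 hX₀.isHermitian).ne, (hbot.trans_le hle).ne'⟩ with z₀
  exact ⟨z₀, zₜ, hmax₀, hmaxₜ, EReal.coe_le_coe_iff.mp hle⟩
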